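/- Let $\Gamma$ be a topological semigroup acting continuously on a locally compact space $\Omega$, and let $\mu$ be a Borel probability measure on $\Gamma$ (multiplication in $\Gamma$ being measurable for the product of the Borel $\sigma$-algebras, as is automatic when $\Gamma$ is second countable, so that the convolution powers $\mu^{*n}$, $n\ge 1$, are defined; $\mu^{*0}*\delta_x$ means $\delta_x$). Let $\overline\Omega=\Omega\cup\{\infty\}$ be the Alexandroff compactification. A subset of $\Omega$ is called a neighborhood of $Y\subseteq\overline\Omega$ if it contains the trace on $\Omega$ of a neighborhood of $Y$ in $\overline\Omega$. Let $\mathcal S\subseteq\mathscr P(\overline\Omega)\times\mathscr P(\overline\Omega)$, let $p_1(\mathcal S)$ be its first projection, and for $Y\in p_1(\mathcal S)$ put $\mathcal S_Y=\{Y' : (Y,Y')\in\mathcal S\}$. Assume that the $\mu$-walk on $\Omega$ has a *controlled drift away from $\mathcal S$*, that is: * there is a linear representation $\Phi:\Gamma\to \mathrm{SL}^{\pm}(V)=\{g\in \mathrm{GL}(V): \det g=\pm1\}$ on a nonzero finite-dimensional normed real vector space $V$ with $\int_\Gamma\log\|\Phi(g)\|\,d\mu(g)<+\infty$ ($\log\|\Phi\|$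 being $\mu$-integrable, $\|\cdot\|$ the operator norm); * there are constants $\lambda,C>0$ such that for every $\alpha>0$ there is $N\ge 1$ such that for every $n\ge N$, every $Y\in p_1(\mathcal S)$ and every compact $K\subseteq\Omega$ with $K\cap Y=\varnothing$, there are $Y'\in\mathcal S_Y$ and a measurable function $f:\Omega\to[0,+\infty]$ which is bounded on $K$, whose upper level sets $\{f>R\}$, $0\le R<\infty$, are neighborhoods of $Y'$, and which satisfies: 1. (probable decrease) there is $T\in[0,+\infty)$ such that for all $x\in f^{-1}[T,+\infty)$, $\mu^{*n}(g : f(gx)\le f(x)-n\lambda)\ge 1-\alpha$; 2. (control of variations) for all $x\in f^{-1}[0,+\infty)$ and all $g\in\Gamma$, $f(gx)-f(x)\le C\log\|\Phi(g)\|$. Then for every $Y\in p_1(\mathcal S)$ and every compact set $K\subseteq\Omega\smallsetminus Y$, there is $Y'\in\mathcal S_Y$ such that for every $\varepsilon>0$ there is a neighborhood $O'\subseteq\Omega$ of $Y'$ such that for all $x\in K$: * (i) for every $n\ge0$, $(\mu^{*n}*\delta_x)(O')<\varepsilon$; * (ii) for $\mu^{\otimes\mathbb N^*}$-almost every $(g_i)_{i\ge1}$,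 $$\limsup_{n\to+\infty}\frac1n\,\mathrm{card}\{k\in\{1,\dots,n\} : g_k\cdots g_1x\in O'\}<\varepsilon .$$ -/

import Mathlib

open MeasureTheory Filter Topology
open scoped ENNReal NNReal

noncomputable section

/-- The convolution power `μ^{*n}`, for `n ≥ 1`: the law of the product of `n` independent
elements of law `μ`. A semigroup need not have a unit, so there is no `μ^{*0}`; the value at `0` is
a placeholder that is not used below. -/
def convPow {Γ : Type*} [Semigroup Γ] [MeasurableSpace Γ] (μ : Measure Γ) : ℕ → Measure Γ
  | 0 => 0
  | 1 => μ
  | n + 2 => (μ.prod (convPow μ (n + 1))).map (fun p : Γ × Γ => p.1 * p.2)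

/-- The `n`-step distribution `μ^{*n} * δ_x` of the `μ`-walk started at `x`: the image of `μ^{*n}`
under `g ↦ g x` if `n ≥ 1`, and `δ_x` at time `0`. -/
def stepLaw {Γ Ω : Type*} [Semigroup Γ] [MeasurableSpace Γ] [SMul Γ Ω] [MeasurableSpace Ω]
    (μ : Measure Γ) (n : ℕ) (x : Ω) : Measure Ω :=
  if n = 0 then Measure.dirac x else (convPow μ n).map (fun g => g • x)

/-- The position `g_n ⋯ g_1 x` at time `n` of the trajectory started at `x` with instructions
`(g_i)_{i ≥ 1}`; the instruction `g_{i+1}` is stored as `g i`. -/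
def trajectory {Γ Ω : Type*} [SMul Γ Ω] (g : ℕ → Γ) (x : Ω) : ℕ → Ω
  | 0 => x
  | n + 1 => g n • trajectory g x n

/-- The set `A ⊆ Ω` is (the trace on `Ω` of) a neighbourhood of the subset `Y` of the Alexandroff
compactification of `Ω`. In particular, if `∞ ∈ Y` then `A` contains a neighbourhood of infinity. -/
def IsNbhdOf {Ω : Type*} [TopologicalSpace Ω] (A : Set Ω) (Y : Set (OnePoint Ω)) : Prop :=
  ∃ O ∈ 𝓝ˢ Y, ((↑) : Ω → OnePoint Ω) ⁻¹' O ⊆ A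

/-- `f` is a drift function, at time `n`, for the set `K`, the target `Y'` and the region `Q`.
Both inequalities are written without subtraction, so that nothing is truncated. In the control of
variations, `log ‖Φ g‖ ≥ 0` because `det (Φ g) = ±1` (see `ControlledDrift`). -/
structure IsDriftFunction {Γ Ω : Type*} [Semigroup Γ] [MeasurableSpace Γ]
    [SMul Γ Ω] [TopologicalSpace Ω] [MeasurableSpace Ω]
    (μ : Measure Γ) {V : Type} [NormedAddCommGroup V] [NormedSpace ℝ V]
    (Φ : Γ →ₙ* (V →L[ℝ] V)) (l C α : ℝ) (n : ℕ)
    (K : Set Ω) (Y' : Set (OnePoint Ω)) (Q : Set Ω) (f : Ω → ℝ≥0∞) : Prop where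
  measurable : Measurable f
  bounded_on : ∃ B : ℝ≥0, ∀ x ∈ K, f x ≤ B
  upper_level : ∀ R : ℝ≥0, IsNbhdOf {x | (R : ℝ≥0∞) < f x} Y'
  probable_decrease : ∃ T : ℝ≥0, ∀ x ∈ Q, (T : ℝ≥0∞) ≤ f x → f x < ∞ →
    ENNReal.ofReal (1 - α) ≤ convPow μ n {g | f (g • x) + ENNReal.ofReal (n * l) ≤ f x}
  control_of_variations : ∀ x, f x < ∞ → ∀ g : Γ,
    f (g • x) ≤ f x + ENNReal.ofReal (C * Real.log ‖Φ g‖)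

/-- The `μ`-walk on `Ω` has a controlled drift away from `S` on `A`, where `S` is a set of pairs of
subsets of the Alexandroff compactification of `Ω` and `A` a set of subsets of `Ω`. The
representation `Φ` takes values in `SL^±(V)`, and `‖Φ g‖` is the operator norm. Up to isometry,
every finite-dimensional normed space lives in `Type`. -/
def ControlledDrift {Γ Ω : Type*} [Semigroup Γ] [MeasurableSpace Γ]
    [SMul Γ Ω] [TopologicalSpace Ω] [MeasurableSpace Ω] (μ : Measure Γ)
    (S : Set (Set (OnePoint Ω) × Set (OnePoint Ω))) (A : Set (Set Ω)) : Prop :=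
  ∃ (V : Type) (_ : NormedAddCommGroup V) (_ : NormedSpace ℝ V) (_ : FiniteDimensional ℝ V)
    (_ : Nontrivial V) (Φ : Γ →ₙ* (V →L[ℝ] V)),
    (∀ g, (Φ g).det = 1 ∨ (Φ g).det = -1) ∧
    Integrable (fun g => Real.log ‖Φ g‖) μ ∧
    ∃ l > (0 : ℝ), ∃ C > (0 : ℝ), ∀ α > (0 : ℝ), ∃ N ≥ 1, ∀ n ≥ N,
      ∀ Y ∈ Prod.fst '' S, ∀ K : Set Ω, IsCompact K → Disjoint ((↑) '' K) Y → ∀ Q ∈ A,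
        ∃ Y', (Y, Y') ∈ S ∧ ∃ f : Ω → ℝ≥0∞, IsDriftFunction μ Φ l C α n K Y' Q f

end

/-! If `log ‖Φ‖` had exponential moments, `exp (s * f)` would contract on average along the walk.
Only a first moment is available, so the large increments of `f` must be removed. Let `w` be an
integrable bound for these increments. The excess of `w` over a level `L` is fed to a queue that
serves `l / 8` per step, and the waiting time is subtracted from `f`. This compensated height `U`
grows by at most `L + l / 8` per step. Over a block of `n` steps starting where `f ≥ T` it still
drops by `7 * n * l / 8` with probability at least `1 - α`, since the queue loses at most `l / 8`
per step. Hence `exp (s * U)`, read at multiples of `n`, contracts by a factor `ρ < 1` up to an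
additive constant (`geometricDrift_compensatedHeight`).

Now `f` is large only if the queue is loaded or `U` was large at the start of the block.
Conservation of work bounds both the probability and the frequency of a loaded queue by the mean
excess, small for large `L`. For `U`, Markov's inequality gives (i), and an exponential
supermartingale with Borel–Cantelli gives (ii). The neighborhood is `{f > R}`.

The target, `f`, `α` and `n` must be fixed before `ε`, whereas `L` depends on `ε`. The block
estimate therefore uses a second truncation level `M`, independent of `ε`, and never needs `α * L`
to be small. -/

noncomputable section

/-! ### Independent sequences and resampling of the future -/

section Splice

/-- The sequence whose first `m` terms are those of `g`, followed by the sequence `h`. -/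
def splice {Γ : Type*} (m : ℕ) (g h : ℕ → Γ) : ℕ → Γ :=
  fun i => if i < m then g i else h (i - m)

theorem splice_of_lt {Γ : Type*} {m i : ℕ} (hi : i < m) (g h : ℕ → Γ) :
    splice m g h i = g i := by simp [splice, hi]

theorem splice_add {Γ : Type*} (m i : ℕ) (g h : ℕ → Γ) : splice m g h (m + i) = h i := by
  simp [splice]

theorem DependsOn.apply_splice {Γ β : Type*} {F : (ℕ → Γ) → β} {m : ℕ}
    (hF : DependsOn F (Set.Iio m)) (g h : ℕ → Γ) : F (splice m g h) = F g :=
  hF fun _ hi => splice_of_lt hi g h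

variable {Γ : Type*} [MeasurableSpace Γ] (μ : Measure Γ) [IsProbabilityMeasure μ]

/-- The law of a sequence of independent elements of law `μ`. -/
abbrev seqLaw : Measure (ℕ → Γ) := Measure.infinitePi (fun _ : ℕ => μ)

theorem measurable_splice (m : ℕ) :
    Measurable (fun p : (ℕ → Γ) × (ℕ → Γ) => splice m p.1 p.2) := by
  refine measurable_pi_iff.2 fun i => ?_
  by_cases hi : i < m
  · simp only [splice, hi, if_true]; fun_prop
  · simp only [splice, hi, if_false]; fun_prop

/-- A cylinder splits into conditions on the indices below `m` and shifted conditions on the others,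
so its measure factorises. -/
theorem measurePreserving_splice (m : ℕ) :
    MeasurePreserving (fun p : (ℕ → Γ) × (ℕ → Γ) => splice m p.1 p.2)
      ((seqLaw μ).prod (seqLaw μ)) (seqLaw μ) := by
  classical
  refine ⟨measurable_splice m, Measure.eq_infinitePi _ fun s t ht => ?_⟩
  rw [Measure.map_apply (measurable_splice m) (.pi s.countable_toSet fun i _ => ht i)]
  have hpre : (fun p : (ℕ → Γ) × (ℕ → Γ) => splice m p.1 p.2) ⁻¹' ((s : Set ℕ).pi t)
      = (((s.filter (· < m) : Finset ℕ) : Set ℕ).pi t) ×ˢ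
        ((((s.filter (¬ · < m)).image (· - m) : Finset ℕ) : Set ℕ).pi fun i => t (m + i)) := by
    ext ⟨g, h⟩
    simp only [Set.mem_preimage, Set.mem_pi, Set.mem_prod, Finset.mem_coe, Finset.mem_filter,
      Finset.mem_image]
    constructor
    · intro H
      refine ⟨fun i hi => ?_, ?_⟩
      · have := H i hi.1
        rwa [splice_of_lt hi.2] at this
      · rintro _ ⟨i, ⟨hi, him⟩, rfl⟩
        have := H i hi
        obtain ⟨j, rfl⟩ := Nat.exists_eq_add_of_le (not_lt.1 him)
        rw [splice_add] at this
        simpa using this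
    · rintro ⟨H1, H2⟩ i hi
      by_cases him : i < m
      · rw [splice_of_lt him]; exact H1 i ⟨hi, him⟩
      · obtain ⟨j, rfl⟩ := Nat.exists_eq_add_of_le (not_lt.1 him)
        rw [splice_add]
        exact H2 j ⟨m + j, ⟨hi, him⟩, by simp⟩
  rw [hpre, Measure.prod_prod, Measure.infinitePi_pi _ (fun i _ => ht i),
    Measure.infinitePi_pi _ (fun i _ => ht (m + i)), Finset.prod_image]
  · rw [← Finset.prod_filter_mul_prod_filter_not s (· < m)]
    congr 1
    refine Finset.prod_congr rfl fun i hi => ?_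
    rw [Nat.add_sub_cancel' (not_lt.1 (Finset.mem_filter.1 hi).2)]
  · intro i hi j hj hij
    simp only [Finset.coe_filter, Set.mem_ofPred_eq] at hi hj
    simp only at hij
    omega

/-- The Markov property at time `m`, by Fubini: the past `g` is frozen while a fresh future `h` is
integrated. -/
theorem lintegral_seqLaw_splice (m : ℕ) {F : (ℕ → Γ) → ℝ≥0∞} (hF : Measurable F) :
    ∫⁻ g, F g ∂(seqLaw μ) = ∫⁻ g, ∫⁻ h, F (splice m g h) ∂(seqLaw μ) ∂(seqLaw μ) := by
  rw [← (measurePreserving_splice μ m).lintegral_comp hF,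
    lintegral_prod (fun p : (ℕ → Γ) × (ℕ → Γ) => F (splice m p.1 p.2))
      (hF.comp (measurable_splice m)).aemeasurable]

theorem measurePreserving_shift :
    MeasurePreserving (fun g : ℕ → Γ => fun i => g (i + 1)) (seqLaw μ) (seqLaw μ) :=
  ⟨by fun_prop,
    Measure.map_infinitePi_infinitePi_of_inj (P := fun _ : ℕ => μ) (add_left_injective 1)⟩

theorem measurePreserving_eval_seqLaw (i : ℕ) :
    MeasurePreserving (fun g : ℕ → Γ => g i) (seqLaw μ) μ :=
  measurePreserving_eval_infinitePi (fun _ : ℕ => μ) i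

theorem ae_seqLaw_forall {p : Γ → Prop} (hp : ∀ᵐ g ∂μ, p g) :
    ∀ᵐ g ∂(seqLaw μ), ∀ i, p (g i) :=
  ae_all_iff.2 fun i => (measurePreserving_eval_seqLaw μ i).quasiMeasurePreserving.ae hp

/-- The strong law of large numbers for functions of the coordinates. -/
theorem ae_tendsto_average_seqLaw {v : Γ → ℝ} (hv : Measurable v) (hvi : Integrable v μ) :
    ∀ᵐ g ∂(seqLaw μ), Tendsto (fun n : ℕ => (∑ i ∈ Finset.range n, v (g i)) / n) atTop
      (𝓝 (∫ x, v x ∂μ)) := by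
  have hmp := measurePreserving_eval_seqLaw μ
  have hind := ProbabilityTheory.iIndepFun_infinitePi (P := fun _ : ℕ => μ)
    (X := fun _ : ℕ => v) (fun _ => hv)
  have key := ProbabilityTheory.strong_law_ae_real (μ := seqLaw μ) (fun i g => v (g i))
    ((hmp 0).integrable_comp_of_integrable hvi) (fun i j hij => hind.indepFun hij)
    (fun i => ⟨(hv.comp (measurable_pi_apply i)).aemeasurable,
      (hv.comp (measurable_pi_apply 0)).aemeasurable, by
        change (seqLaw μ).map (v ∘ fun g : ℕ → Γ => g i) = (seqLaw μ).map (v ∘ fun g => g 0)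
        rw [← Measure.map_map hv (hmp i).measurable, ← Measure.map_map hv (hmp 0).measurable,
          (hmp i).map_eq, (hmp 0).map_eq]⟩)
  have hE : ∫ g, v (g 0) ∂(seqLaw μ) = ∫ x, v x ∂μ := by
    have := integral_map (μ := seqLaw μ) (φ := fun g : ℕ → Γ => g 0)
      (measurable_pi_apply 0).aemeasurable (f := v) hv.aestronglyMeasurable
    rw [(hmp 0).map_eq] at this
    exact this.symm
  rw [hE] at key
  exact key

end Splice

/-! ### Trajectories and convolution powers -/

section Trajectory

variable {Γ Ω : Type*}

/-- The product `g_{m+1} ⋯ g_1` of the first `m + 1` terms, the latest on the left. -/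
def leftProd [Semigroup Γ] (g : ℕ → Γ) : ℕ → Γ
  | 0 => g 0
  | m + 1 => g (m + 1) * leftProd g m

theorem dependsOn_leftProd [Semigroup Γ] (m : ℕ) :
    DependsOn (fun g : ℕ → Γ => leftProd g m) (Set.Iio (m + 1)) := by
  induction m with
  | zero => intro g h H; exact H 0 (by simp)
  | succ m ih =>
    intro g h H
    have h1 := ih (x := g) (y := h) fun i hi => H i (by simp at hi ⊢; omega)
    have h2 := H (m + 1) (by simp)
    simp only [leftProd] at h1 ⊢
    rw [h1, h2]

theorem trajectory_succ_eq_leftProd_smul [Semigroup Γ] [SemigroupAction Γ Ω] (g : ℕ → Γ) (x : Ω)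
    (m : ℕ) : trajectory g x (m + 1) = leftProd g m • x := by
  induction m with
  | zero => rfl
  | succ m ih => rw [trajectory, ih, leftProd, mul_smul]

theorem dependsOn_trajectory [SMul Γ Ω] (x : Ω) (m : ℕ) :
    DependsOn (fun g : ℕ → Γ => trajectory g x m) (Set.Iio m) := by
  induction m with
  | zero => intro g h _; rfl
  | succ m ih =>
    intro g h H
    have h1 := ih (x := g) (y := h) fun i hi => H i (by simp at hi ⊢; omega)
    have h2 := H m (by simp)
    simp only [trajectory] at h1 ⊢
    rw [h1, h2]

theorem trajectory_splice_add [SMul Γ Ω] (m k : ℕ) (g h : ℕ → Γ) (x : Ω) :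
    trajectory (splice m g h) x (m + k) = trajectory h (trajectory g x m) k := by
  induction k with
  | zero => exact (dependsOn_trajectory x m).apply_splice g h
  | succ k ih => rw [← add_assoc, trajectory, trajectory, ih, splice_add]

variable [Semigroup Γ] [MeasurableSpace Γ] [MeasurableMul₂ Γ]

theorem measurable_leftProd (m : ℕ) : Measurable (fun g : ℕ → Γ => leftProd g m) := by
  induction m with
  | zero => exact measurable_pi_apply 0
  | succ m ih => exact (measurable_pi_apply (m + 1)).mul ih

theorem map_leftProd_seqLaw (μ : Measure Γ) [IsProbabilityMeasure μ] (m : ℕ) :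
    (seqLaw μ).map (fun g => leftProd g m) = convPow μ (m + 1) := by
  induction m with
  | zero => exact (measurePreserving_eval_seqLaw μ 0).map_eq
  | succ m ih =>
    have hmp : MeasurePreserving (Prod.map (fun g : ℕ → Γ => g 0) (fun g => leftProd g m))
        ((seqLaw μ).prod (seqLaw μ)) (μ.prod (convPow μ (m + 1))) := by
      have : IsProbabilityMeasure (convPow μ (m + 1)) :=
        ih ▸ Measure.isProbabilityMeasure_map (measurable_leftProd m).aemeasurable
      exact (measurePreserving_eval_seqLaw μ 0).prod ⟨measurable_leftProd m, ih⟩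
    -- In `convPow` the newest factor is the first component, whereas splicing takes the past first;
    -- hence the swap.
    have hsw := (measurePreserving_splice μ (m + 1)).comp
      (Measure.measurePreserving_swap (μ := seqLaw μ) (ν := seqLaw μ))
    rw [convPow, ← hmp.map_eq, Measure.map_map measurable_mul hmp.measurable]
    conv_lhs => rw [← hsw.map_eq]
    rw [Measure.map_map (measurable_leftProd (m + 1)) hsw.measurable]
    congr 1
    funext ⟨h, g⟩
    have h1 : leftProd (splice (m + 1) g h) m = leftProd g m :=
      (dependsOn_leftProd m).apply_splice g h
    have h2 : splice (m + 1) g h (m + 1) = h 0 := splice_add (m + 1) 0 g h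
    simp only [Function.comp, Prod.swap, Prod.map, leftProd, h1, h2]

variable [TopologicalSpace Γ] [BorelSpace Γ] [TopologicalSpace Ω] [MeasurableSpace Ω]
  [BorelSpace Ω] [SemigroupAction Γ Ω] [ContinuousSMul Γ Ω]

theorem measurable_trajectory (x : Ω) (m : ℕ) :
    Measurable (fun g : ℕ → Γ => trajectory g x m) := by
  cases m with
  | zero => exact measurable_const
  | succ m =>
    simp only [trajectory_succ_eq_leftProd_smul]
    exact (show Continuous fun γ : Γ => γ • x by fun_prop).measurable.comp (measurable_leftProd m)

/-- Moves (i) to the sequence space, where (ii) already lives. -/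
theorem stepLaw_apply (μ : Measure Γ) [IsProbabilityMeasure μ] (m : ℕ) (x : Ω) {A : Set Ω}
    (hA : MeasurableSet A) : stepLaw μ m x A = seqLaw μ {g | trajectory g x m ∈ A} := by
  cases m with
  | zero =>
    simp only [stepLaw, if_true, Measure.dirac_apply' x hA, trajectory]
    by_cases hx : x ∈ A <;> simp [hx]
  | succ m =>
    have hs : Measurable fun γ : Γ => γ • x :=
      (show Continuous fun γ : Γ => γ • x by fun_prop).measurable
    simp only [stepLaw, Nat.succ_ne_zero, if_false, trajectory_succ_eq_leftProd_smul]
    rw [Measure.map_apply hs hA, ← map_leftProd_seqLaw,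
      Measure.map_apply (measurable_leftProd m) (hs hA)]
    rfl

end Trajectory

/-! ### The queue fed by the large increments -/

section Queue

/-- The waiting time in a queue: at each step the load `v (g k)` arrives and `c` is served. -/
def queue {Γ : Type*} (v : Γ → ℝ) (c : ℝ) (g : ℕ → Γ) : ℕ → ℝ
  | 0 => 0
  | k + 1 => max (queue v c g k + v (g k) - c) 0

variable {Γ : Type*} {v : Γ → ℝ} {c : ℝ}

theorem queue_nonneg (g : ℕ → Γ) (k : ℕ) : 0 ≤ queue v c g k := by
  cases k with
  | zero => exact le_rfl
  | succ k => exact le_max_right _ _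

theorem le_queue_succ (g : ℕ → Γ) (k : ℕ) :
    queue v c g k + v (g k) - c ≤ queue v c g (k + 1) := le_max_left _ _

theorem sub_le_queue_add (hv : ∀ γ, 0 ≤ v γ) (g : ℕ → Γ) (m k : ℕ) :
    queue v c g m - k * c ≤ queue v c g (m + k) := by
  induction k with
  | zero => simp
  | succ k ih =>
    have h1 := le_queue_succ (v := v) (c := c) g (m + k)
    have h2 := hv (g (m + k))
    rw [← add_assoc]
    push_cast
    linarith

theorem dependsOn_queue (k : ℕ) : DependsOn (fun g : ℕ → Γ => queue v c g k) (Set.Iio k) := by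
  induction k with
  | zero => intro g h _; rfl
  | succ k ih =>
    intro g h H
    have h1 := ih (x := g) (y := h) fun i hi => H i (by simp at hi ⊢; omega)
    have h2 := H k (by simp)
    simp only [queue] at h1 ⊢
    rw [h1, h2]

/-- The total service time spent on loaded queues is at most the total load. -/
theorem mul_sum_queue_le (hv : ∀ γ, 0 ≤ v γ) (hc : 0 ≤ c) (g : ℕ → Γ) (N : ℕ) :
    c * ∑ k ∈ Finset.range N, (if c ≤ queue v c g k then (1 : ℝ) else 0) + queue v c g N
      ≤ ∑ k ∈ Finset.range N, v (g k) := by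
  induction N with
  | zero => simp [queue]
  | succ N ih =>
    rw [Finset.sum_range_succ, Finset.sum_range_succ]
    have h2 := hv (g N)
    have h3 := queue_nonneg (v := v) (c := c) g N
    have h4 := hc
    simp only [queue]
    -- A queue of length at least `c` is served in full, so the maximum does not truncate; a shorter
    -- one is not counted, and it grows by at most its load.
    split_ifs with h
    · rw [max_eq_left (by linarith)]; linarith
    · have : max (queue v c g N + v (g N) - c) 0 ≤ queue v c g N + v (g N) :=
        max_le (by linarith) (by linarith)
      linarith

/-- The recursion is monotone in the initial state, and at time `1` the shifted queue is empty. -/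
theorem queue_shift_le (g : ℕ → Γ) (k : ℕ) :
    queue v c (fun i => g (i + 1)) k ≤ queue v c g (k + 1) := by
  induction k with
  | zero => exact queue_nonneg g 1
  | succ k ih => exact max_le_max (by linarith) le_rfl

variable [MeasurableSpace Γ]

theorem measurable_queue (hv : Measurable v) (k : ℕ) :
    Measurable (fun g : ℕ → Γ => queue v c g k) := by
  induction k with
  | zero => exact measurable_const
  | succ k ih =>
    exact ((ih.add (hv.comp (measurable_pi_apply k))).sub_const c).max measurable_const

variable {μ : Measure Γ} [IsProbabilityMeasure μ]

theorem measurableSet_le_queue (hvm : Measurable v) (k : ℕ) :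
    MeasurableSet {g : ℕ → Γ | c ≤ queue v c g k} :=
  measurableSet_le measurable_const (measurable_queue hvm k)

theorem monotone_measureReal_le_queue (hvm : Measurable v) :
    Monotone fun k => (seqLaw μ).real {g | c ≤ queue v c g k} := by
  refine monotone_nat_of_le_succ fun k => ?_
  rw [← (measurePreserving_shift μ).measureReal_preimage
    (measurableSet_le_queue hvm k).nullMeasurableSet]
  exact measureReal_mono fun g hg => le_trans hg (queue_shift_le g k)

/-- Integrating `mul_sum_queue_le` bounds only time averages of the probabilities. As these increase
with time, the average over a long window after `k` dominates the one at `k`. -/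
theorem mul_measureReal_le_queue_le (hv : ∀ γ, 0 ≤ v γ) (hvm : Measurable v)
    (hvi : Integrable v μ) (hc : 0 ≤ c) (k : ℕ) :
    c * (seqLaw μ).real {g | c ≤ queue v c g k} ≤ ∫ x, v x ∂μ := by
  set p : ℕ → ℝ := fun k => (seqLaw μ).real {g | c ≤ queue v c g k} with hp
  have hmp := measurePreserving_eval_seqLaw μ
  have hvint : ∀ i, Integrable (fun g : ℕ → Γ => v (g i)) (seqLaw μ) := fun i =>
    (hmp i).integrable_comp_of_integrable hvi
  have hE : ∀ i, ∫ g, v (g i) ∂(seqLaw μ) = ∫ x, v x ∂μ := fun i => by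
    have := integral_map (μ := seqLaw μ) (φ := fun g : ℕ → Γ => g i)
      (measurable_pi_apply i).aemeasurable (f := v) hvm.aestronglyMeasurable
    rw [(hmp i).map_eq] at this
    exact this.symm
  have hind : ∀ i, (fun g : ℕ → Γ => if c ≤ queue v c g i then (1 : ℝ) else 0)
      = {g | c ≤ queue v c g i}.indicator 1 := fun i => by
    funext g; simp [Set.indicator_apply]
  have hindint : ∀ i, Integrable (fun g : ℕ → Γ => if c ≤ queue v c g i then (1 : ℝ) else 0)
      (seqLaw μ) := fun i => by
    rw [hind]
    exact (integrable_const (1 : ℝ)).indicator (measurableSet_le_queue hvm i)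
  have hpi : ∀ i, ∫ g, (if c ≤ queue v c g i then (1 : ℝ) else 0) ∂(seqLaw μ) = p i := fun i => by
    rw [hind, integral_indicator_one (measurableSet_le_queue hvm i)]
  have hsum : ∀ N : ℕ, c * ∑ i ∈ Finset.range N, p i ≤ N * ∫ x, v x ∂μ := fun N => by
    have h1 : ∫ g, c * ∑ i ∈ Finset.range N, (if c ≤ queue v c g i then (1 : ℝ) else 0) ∂(seqLaw μ)
        ≤ ∫ g, ∑ i ∈ Finset.range N, v (g i) ∂(seqLaw μ) := by
      refine integral_mono ((integrable_finsetSum _ fun i _ => hindint i).const_mul c)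
        (integrable_finsetSum _ fun i _ => hvint i) fun g => ?_
      have h1 := mul_sum_queue_le hv hc g N
      have h2 := queue_nonneg (v := v) (c := c) g N
      simp only
      linarith
    rw [integral_const_mul, integral_finsetSum _ fun i _ => hindint i,
      integral_finsetSum _ fun i _ => hvint i] at h1
    simpa [hpi, hE] using h1
  have hη : 0 ≤ ∫ x, v x ∂μ := integral_nonneg hv
  have hlow : ∀ N : ℕ, N * (c * p k) ≤ (k + N) * ∫ x, v x ∂μ := fun N => by
    have h1 := hsum (k + N)
    rw [Finset.sum_range_add] at h1
    have h2 : 0 ≤ ∑ i ∈ Finset.range k, p i := Finset.sum_nonneg fun i _ => measureReal_nonneg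
    have h3 : (N : ℝ) * p k ≤ ∑ i ∈ Finset.range N, p (k + i) := by
      rw [← nsmul_eq_mul]
      simpa using Finset.card_nsmul_le_sum (Finset.range N) (fun i => p (k + i)) (p k)
        fun i _ => monotone_measureReal_le_queue hvm (Nat.le_add_right k i)
    push_cast at h1
    nlinarith [mul_le_mul_of_nonneg_left h3 hc, mul_nonneg hc h2]
  by_contra hcon
  have hd : 0 < c * p k - ∫ x, v x ∂μ := by simpa [hp] using hcon
  obtain ⟨N, hN⟩ := exists_nat_gt (k * (∫ x, v x ∂μ) / (c * p k - ∫ x, v x ∂μ))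
  rw [div_lt_iff₀ hd] at hN
  have := hlow N
  nlinarith

theorem ae_eventually_sum_queue_le (hv : ∀ γ, 0 ≤ v γ) (hvm : Measurable v)
    (hvi : Integrable v μ) (hc : 0 < c) {δ : ℝ} (hδ : ∫ x, v x ∂μ < c * δ) :
    ∀ᵐ g ∂(seqLaw μ), ∀ᶠ N : ℕ in atTop,
      ∑ k ∈ Finset.range N, (if c ≤ queue v c g k then (1 : ℝ) else 0) ≤ δ * N := by
  filter_upwards [ae_tendsto_average_seqLaw μ hvm hvi] with g hg
  filter_upwards [hg.eventually_lt_const hδ, eventually_gt_atTop 0] with N hN hN0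
  have hN0' : (0 : ℝ) < N := by exact_mod_cast hN0
  rw [div_lt_iff₀ hN0'] at hN
  have h1 := mul_sum_queue_le hv hc.le g N
  have h2 := queue_nonneg (v := v) (c := c) g N
  refine le_of_mul_le_mul_left ?_ hc
  linarith

end Queue

/-! ### Processes with geometric drift -/

section GeometricDrift

/-- The exponential weight counting the exceedances of the level `y`. -/
def exceedanceWeight {Γ : Type*} (Y : ℕ → (ℕ → Γ) → ℝ) (y a d : ℝ) (q : ℕ) (g : ℕ → Γ) :
    ℝ :=
  Real.exp (a * ∑ i ∈ Finset.range q, (if y < Y i g then (1 : ℝ) else 0) - d * q)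

/-- The weight of index `q + 1` involves `Y i` only for `i ≤ q`, so it is an admissible test
function in the drift inequality at `q`. -/
theorem dependsOn_exceedanceWeight_succ {Γ : Type*} {n : ℕ} {Y : ℕ → (ℕ → Γ) → ℝ}
    (hY : ∀ q, DependsOn (Y q) (Set.Iio (n * q)))
    (y a d : ℝ) (q : ℕ) :
    DependsOn (exceedanceWeight Y y a d (q + 1)) (Set.Iio (n * q)) := by
  intro g h H
  have : ∀ i ∈ Finset.range (q + 1), Y i g = Y i h := fun i hi =>
    (hY i).mono (Set.Iio_subset_Iio
      (Nat.mul_le_mul_left n (Nat.lt_succ_iff.1 (Finset.mem_range.1 hi)))) H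
  unfold exceedanceWeight
  rw [Finset.sum_congr rfl fun i hi => by rw [this i hi]]

variable {Γ : Type*} [MeasurableSpace Γ]

/-- A nonnegative process, adapted to the first `n * q` coordinates, whose conditional expectations
contract by the factor `ρ` up to the additive constant `b`. -/
structure GeometricDrift (μ : Measure Γ) [IsProbabilityMeasure μ] (n : ℕ) (ρ b : ℝ)
    (Y : ℕ → (ℕ → Γ) → ℝ) : Prop where
  measurable : ∀ q, Measurable (Y q)
  nonneg : ∀ q g, 0 ≤ Y q g
  dependsOn : ∀ q, DependsOn (Y q) (Set.Iio (n * q))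
  drift : ∀ q (H : (ℕ → Γ) → ℝ≥0∞), Measurable H → DependsOn H (Set.Iio (n * q)) →
    ∫⁻ g, H g * ENNReal.ofReal (Y (q + 1) g) ∂(seqLaw μ)
      ≤ ∫⁻ g, H g * ENNReal.ofReal (ρ * Y q g + b) ∂(seqLaw μ)

variable {μ : Measure Γ} [IsProbabilityMeasure μ] {n : ℕ} {ρ b : ℝ} {Y : ℕ → (ℕ → Γ) → ℝ}

theorem GeometricDrift.lintegral_le (hY : GeometricDrift μ n ρ b Y) (hρ0 : 0 ≤ ρ) (hρ : ρ < 1)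
    (hb : 0 ≤ b) {C₀ : ℝ} (hC₀ : 0 ≤ C₀) (h0 : ∀ g, Y 0 g ≤ C₀) (q : ℕ) :
    ∫⁻ g, ENNReal.ofReal (Y q g) ∂(seqLaw μ) ≤ ENNReal.ofReal (C₀ + b / (1 - ρ)) := by
  have h1ρ : 0 < 1 - ρ := by linarith
  have hb' : 0 ≤ b / (1 - ρ) := by positivity
  induction q with
  | zero =>
    calc _ ≤ ∫⁻ _, ENNReal.ofReal (C₀ + b / (1 - ρ)) ∂(seqLaw μ) :=
          lintegral_mono fun g => ENNReal.ofReal_le_ofReal (by linarith [h0 g])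
      _ = _ := by simp
  | succ q ih =>
    have h := hY.drift q 1 measurable_const (fun _ _ _ => rfl)
    simp only [Pi.one_apply, one_mul] at h
    refine h.trans ?_
    calc ∫⁻ g, ENNReal.ofReal (ρ * Y q g + b) ∂(seqLaw μ)
        = ∫⁻ g, (ENNReal.ofReal ρ * ENNReal.ofReal (Y q g) + ENNReal.ofReal b) ∂(seqLaw μ) := by
          refine lintegral_congr fun g => ?_
          rw [ENNReal.ofReal_add (mul_nonneg hρ0 (hY.nonneg q g)) hb, ENNReal.ofReal_mul hρ0]
      _ = ENNReal.ofReal ρ * ∫⁻ g, ENNReal.ofReal (Y q g) ∂(seqLaw μ) + ENNReal.ofReal b := by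
          rw [lintegral_add_right _ measurable_const,
            lintegral_const_mul _ (hY.measurable q).ennreal_ofReal]
          simp
      _ ≤ ENNReal.ofReal ρ * ENNReal.ofReal (C₀ + b / (1 - ρ)) + ENNReal.ofReal b := by gcongr
      _ = ENNReal.ofReal (ρ * (C₀ + b / (1 - ρ)) + b) := by
          rw [ENNReal.ofReal_add (by positivity) hb, ENNReal.ofReal_mul hρ0]
      _ ≤ _ := by
          refine ENNReal.ofReal_le_ofReal ?_
          -- `b / (1 - ρ)` is the fixed point of `t ↦ ρ * t + b`.
          have : b = (1 - ρ) * (b / (1 - ρ)) := by field_simp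
          nlinarith [mul_nonneg h1ρ.le hC₀]

theorem measurable_exceedanceWeight (hY : ∀ q, Measurable (Y q)) (y a d : ℝ) (q : ℕ) :
    Measurable (exceedanceWeight Y y a d q) := by
  refine Real.measurable_exp.comp (((Finset.measurable_sum _ fun i _ => ?_).const_mul a).sub_const _)
  exact Measurable.ite (measurableSet_lt measurable_const (hY i)) measurable_const measurable_const

/-- `hlow` and `hhigh` make the weight times `1 + κ * Y q` a supermartingale: each step pays `exp
(-d)`, and each exceedance is rewarded by `exp a`. -/
theorem GeometricDrift.lintegral_exceedanceWeight_le (hY : GeometricDrift μ n ρ b Y)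
    {C₀ : ℝ} (h0 : ∀ g, Y 0 g ≤ C₀) {κ y a d : ℝ} (hκ : 0 ≤ κ)
    (hρ0 : 0 ≤ ρ) (hb : 0 ≤ b)
    (hlow : ∀ t, 0 ≤ t → Real.exp (-d) * (1 + κ * (ρ * t + b)) ≤ 1 + κ * t)
    (hhigh : ∀ t, y < t → 0 ≤ t → Real.exp (a - d) * (1 + κ * (ρ * t + b)) ≤ 1 + κ * t) (q : ℕ) :
    ∫⁻ g, ENNReal.ofReal (exceedanceWeight Y y a d q g * (1 + κ * Y q g)) ∂(seqLaw μ)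
      ≤ ENNReal.ofReal (1 + κ * C₀) := by
  induction q with
  | zero =>
    calc _ ≤ ∫⁻ _, ENNReal.ofReal (1 + κ * C₀) ∂(seqLaw μ) := by
          refine lintegral_mono fun g => ENNReal.ofReal_le_ofReal ?_
          simp only [exceedanceWeight, Finset.range_zero, Finset.sum_empty, mul_zero,
            Nat.cast_zero, sub_zero, Real.exp_zero, one_mul]
          nlinarith [mul_le_mul_of_nonneg_left (h0 g) hκ]
      _ = _ := by simp
  | succ q ih =>
    refine le_trans ?_ ih
    set W := exceedanceWeight Y y a d (q + 1) with hW
    have hWm : Measurable W := measurable_exceedanceWeight hY.measurable y a d (q + 1)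
    have hWp : ∀ g, 0 ≤ W g := fun g => (Real.exp_pos _).le
    have hsplit : ∀ u : ℝ, 0 ≤ u → ∀ g, ENNReal.ofReal (W g * (1 + κ * u))
        = ENNReal.ofReal (W g) + ENNReal.ofReal (κ * W g) * ENNReal.ofReal u := fun u hu g => by
      rw [← ENNReal.ofReal_mul (mul_nonneg hκ (hWp g)),
        ← ENNReal.ofReal_add (hWp g) (mul_nonneg (mul_nonneg hκ (hWp g)) hu)]
      congr 1; ring
    have hH := hY.drift q (fun g => ENNReal.ofReal (κ * W g)) (hWm.const_mul κ).ennreal_ofReal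
      (fun g h H => by
        simp only [hW, dependsOn_exceedanceWeight_succ hY.dependsOn y a d q H])
    calc ∫⁻ g, ENNReal.ofReal (W g * (1 + κ * Y (q + 1) g)) ∂(seqLaw μ)
        = ∫⁻ g, ENNReal.ofReal (W g) ∂(seqLaw μ)
          + ∫⁻ g, ENNReal.ofReal (κ * W g) * ENNReal.ofReal (Y (q + 1) g) ∂(seqLaw μ) := by
          rw [← lintegral_add_left hWm.ennreal_ofReal]
          exact lintegral_congr fun g => hsplit _ (hY.nonneg _ g) g
      _ ≤ ∫⁻ g, ENNReal.ofReal (W g) ∂(seqLaw μ)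
          + ∫⁻ g, ENNReal.ofReal (κ * W g) * ENNReal.ofReal (ρ * Y q g + b) ∂(seqLaw μ) := by
          gcongr
      _ = ∫⁻ g, ENNReal.ofReal (W g * (1 + κ * (ρ * Y q g + b))) ∂(seqLaw μ) := by
          rw [← lintegral_add_left hWm.ennreal_ofReal]
          exact lintegral_congr fun g =>
            (hsplit _ (add_nonneg (mul_nonneg hρ0 (hY.nonneg _ g)) hb) g).symm
      _ ≤ _ := by
          refine lintegral_mono fun g => ENNReal.ofReal_le_ofReal ?_
          have hsucc : W g = exceedanceWeight Y y a d q g *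
              Real.exp (a * (if y < Y q g then (1 : ℝ) else 0) - d) := by
            rw [hW, exceedanceWeight, exceedanceWeight, ← Real.exp_add, Finset.sum_range_succ]
            congr 1; push_cast; ring
          rw [hsucc, mul_assoc]
          refine mul_le_mul_of_nonneg_left ?_ (Real.exp_pos _).le
          split_ifs with h
          · simpa using hhigh _ h (hY.nonneg q g)
          · simpa using hlow _ (hY.nonneg q g)

/-- The frequency of the exceedances of a high level is almost surely small, with a level that
does not depend on the process. -/
theorem exists_ae_eventually_sum_exceedance_le (hρ0 : 0 ≤ ρ) (hρ : ρ < 1) (hb : 0 ≤ b) {ε : ℝ}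
    (hε : 0 < ε) : ∃ y : ℝ, ∀ Y : ℕ → (ℕ → Γ) → ℝ, GeometricDrift μ n ρ b Y →
      ∀ C₀ : ℝ, (∀ g, Y 0 g ≤ C₀) → ∀ᵐ g ∂(seqLaw μ), ∀ᶠ N : ℕ in atTop,
        ∑ q ∈ Finset.range N, (if y < Y q g then (1 : ℝ) else 0) ≤ ε * N := by
  -- Above the level `y`, `1 + κ * t` contracts by `σ`, strictly between `ρ` and `1`; the reward
  -- `exp a = σ⁻¹` uses up this gain.
  set σ := (1 + ρ) / 2 with hσ
  have hσ0 : 0 < σ := by rw [hσ]; linarith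
  have hσ1 : σ < 1 := by rw [hσ]; linarith
  set a := -Real.log σ with ha
  have ha0 : 0 < a := by rw [ha]; linarith [Real.log_neg hσ0 hσ1]
  have hea : Real.exp a * σ = 1 := by
    rw [ha, Real.exp_neg, Real.exp_log hσ0]; field_simp
  -- Keeps the cost `d = κ * b` per step below `a * ε / 2`, half of what exceedances of frequency
  -- `ε` earn.
  set κ := a * ε / (2 * (b + 1)) with hκ
  have hκ0 : 0 < κ := by positivity
  set d := κ * b with hd
  have hd0 : 0 ≤ d := by positivity
  have hda : d ≤ a * ε / 2 := by
    have : d = a * ε / 2 * (b / (b + 1)) := by rw [hd, hκ]; field_simp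
    rw [this]
    exact mul_le_of_le_one_right (by positivity) ((div_le_one (by linarith)).2 (by linarith))
  have hexpd : 1 + d ≤ Real.exp d := by linarith [Real.add_one_le_exp d]
  have hexpd' : Real.exp (-d) * (1 + d) ≤ 1 := by
    rw [Real.exp_neg, inv_mul_le_iff₀ (Real.exp_pos d)]; linarith
  have hnegd : Real.exp (-d) ≤ 1 := Real.exp_le_one_iff.2 (by linarith)
  set y := (1 + d) / (κ * ((1 - ρ) / 2)) with hy
  have hden : 0 < κ * ((1 - ρ) / 2) := mul_pos hκ0 (by linarith)
  refine ⟨y, fun Y hY C₀ h0 => ?_⟩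
  have key := hY.lintegral_exceedanceWeight_le h0 (κ := κ) (y := y) (a := a) (d := d) hκ0.le hρ0 hb
    (fun t ht => by
      have h1 : κ * (ρ * t) ≤ κ * t := mul_le_mul_of_nonneg_left (by nlinarith) hκ0.le
      have h2 : 0 ≤ κ * (ρ * t) := by positivity
      calc Real.exp (-d) * (1 + κ * (ρ * t + b))
          = Real.exp (-d) * (1 + d) + Real.exp (-d) * (κ * (ρ * t)) := by rw [hd]; ring
        _ ≤ 1 + 1 * (κ * t) := by gcongr
        _ = _ := by ring)
    (fun t hyt ht => by
      have h1 : 1 + d ≤ κ * ((1 - ρ) / 2) * t := by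
        rw [hy, div_lt_iff₀ hden] at hyt; linarith
      have h2 : 1 + κ * (ρ * t + b) ≤ σ * (1 + κ * t) := by
        have e1 : 1 + κ * (ρ * t + b) = 1 + d + κ * ρ * t := by rw [hd]; ring
        have e2 : σ * (1 + κ * t) = σ + κ * ρ * t + κ * ((1 - ρ) / 2) * t := by rw [hσ]; ring
        linarith
      calc Real.exp (a - d) * (1 + κ * (ρ * t + b))
          ≤ Real.exp a * (σ * (1 + κ * t)) := by
            gcongr
            linarith
        _ = _ := by rw [← mul_assoc, hea, one_mul])
  set S : ℕ → (ℕ → Γ) → ℝ := fun N g => ∑ q ∈ Finset.range N, (if y < Y q g then (1 : ℝ) else 0)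
  -- More than `ε * N` exceedances force the weight above `exp (a * ε / 2 * N)`; Markov's inequality
  -- then gives a summable bound.
  have hbound : ∀ N : ℕ, seqLaw μ {g | ¬ S N g ≤ ε * N}
      ≤ ENNReal.ofReal (1 + κ * C₀) * ENNReal.ofReal (Real.exp (-(a * ε / 2))) ^ N := fun N => by
    set F : (ℕ → Γ) → ℝ≥0∞ := fun g =>
      ENNReal.ofReal (exceedanceWeight Y y a d N g * (1 + κ * Y N g))
    have hF : Measurable F := ((measurable_exceedanceWeight hY.measurable y a d N).mul
      (((hY.measurable N).const_mul κ).const_add 1)).ennreal_ofReal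
    have hm := mul_meas_ge_le_lintegral (μ := seqLaw μ) hF
      (ENNReal.ofReal (Real.exp (a * ε / 2 * N)))
    have hsub : {g | ¬ S N g ≤ ε * N} ⊆ {g | ENNReal.ofReal (Real.exp (a * ε / 2 * N)) ≤ F g} := by
      intro g hg
      have hg' : ε * N < S N g := not_le.1 hg
      refine ENNReal.ofReal_le_ofReal ?_
      have h1 : Real.exp (a * ε / 2 * N) ≤ exceedanceWeight Y y a d N g := by
        refine Real.exp_le_exp.2 ?_
        have h2 : a * (ε * N) ≤ a * S N g := mul_le_mul_of_nonneg_left hg'.le ha0.le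
        have h3 : d * N ≤ a * ε / 2 * N := mul_le_mul_of_nonneg_right hda (Nat.cast_nonneg N)
        change a * ε / 2 * N ≤ a * S N g - d * N
        linarith
      have h2 : (0 : ℝ) ≤ κ * Y N g := mul_nonneg hκ0.le (hY.nonneg N g)
      nlinarith [Real.exp_pos (a * ε / 2 * N)]
    have hE : ENNReal.ofReal (Real.exp (-(a * ε / 2))) ^ N
        = (ENNReal.ofReal (Real.exp (a * ε / 2 * N)))⁻¹ := by
      rw [← ENNReal.ofReal_pow (Real.exp_pos _).le, ← ENNReal.ofReal_inv_of_pos (Real.exp_pos _),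
        ← Real.exp_nat_mul, ← Real.exp_neg]
      congr 2; ring
    rw [hE, ← div_eq_mul_inv, ENNReal.le_div_iff_mul_le
      (Or.inl (by simp [Real.exp_pos])) (Or.inl ENNReal.ofReal_ne_top), mul_comm]
    exact (mul_le_mul_right (measure_mono hsub) _).trans (hm.trans (key N))
  have hsum : ∑' N, seqLaw μ {g | ¬ S N g ≤ ε * N} ≠ ∞ := by
    refine ne_top_of_le_ne_top ?_ (ENNReal.tsum_le_tsum hbound)
    rw [ENNReal.tsum_mul_left, ENNReal.tsum_geometric]
    refine ENNReal.mul_ne_top ENNReal.ofReal_ne_top (ENNReal.inv_ne_top.2 ?_)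
    refine (tsub_pos_of_lt ?_).ne'
    rw [← ENNReal.ofReal_one]
    exact (ENNReal.ofReal_lt_ofReal_iff one_pos).2 (Real.exp_lt_one_iff.2 (by
      have : 0 < a * ε / 2 := by positivity
      linarith))
  filter_upwards [ae_eventually_notMem hsum] with g hg
  filter_upwards [hg] with N hN
  exact not_not.1 hN

end GeometricDrift

/-! ### Exponential moment over one block -/

section Block

theorem Real.exp_neg_le_one_sub_half {t : ℝ} (h0 : 0 ≤ t) (h1 : t ≤ 1) :
    Real.exp (-t) ≤ 1 - t / 2 := by
  rw [Real.exp_neg, inv_le_comm₀ (Real.exp_pos t) (by linarith)]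
  refine le_trans ?_ (Real.add_one_le_exp t)
  rw [inv_le_iff_one_le_mul₀ (by linarith)]
  nlinarith

theorem Real.exp_le_one_add_two_mul {t : ℝ} (h0 : 0 ≤ t) (h1 : t ≤ 1) :
    Real.exp t ≤ 1 + 2 * t := by
  have h := Real.abs_exp_sub_one_le (x := t) (by rwa [abs_of_nonneg h0])
  rw [abs_of_nonneg h0] at h
  linarith [le_abs_self (Real.exp t - 1)]

variable {Γ : Type*} [MeasurableSpace Γ] {μ : Measure Γ} [IsProbabilityMeasure μ]

/-- The exponential moment of a variable which is very negative off a set `A` of small probability,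
and at most a sum of `n` truncated independent variables on `A`. -/
theorem lintegral_exp_ite_le {w : Γ → ℝ} (hw0 : ∀ γ, 0 ≤ w γ)
    (hwi : Integrable w μ) {n : ℕ} {l L M α s : ℝ} (hl : 0 ≤ l) (hL : 0 ≤ L) (hM : 0 ≤ M)
    (hs : 0 ≤ s) (hsL : s * (n * L) ≤ 1) (hsl : s * (n * l) ≤ 1)
    (hα : α * l + 2 * (M * α + ∫ γ, max (w γ - M) 0 ∂μ) ≤ l / 4)
    {A : Set (ℕ → Γ)} [DecidablePred (· ∈ A)] (hA : MeasurableSet A)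
    (hAα : (seqLaw μ).real A ≤ α) :
    ∫⁻ h, ENNReal.ofReal (Real.exp (s * (if h ∈ A then ∑ i ∈ Finset.range n, min (w (h i)) L
      + n * (l / 8) else n * (l / 8) - n * l))) ∂(seqLaw μ)
      ≤ ENNReal.ofReal (Real.exp (-(s * (n * l) / 8))) := by
  set δ := ∫ γ, max (w γ - M) 0 ∂μ with hδ
  set p := (seqLaw μ).real A with hp
  set I : (ℕ → Γ) → ℝ := A.indicator 1 with hI
  have hI0 : ∀ h, 0 ≤ I h := fun h => Set.indicator_nonneg (fun _ _ => zero_le_one) h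
  have hIi : Integrable I (seqLaw μ) := (integrable_const (1 : ℝ)).indicator hA
  have hmp := measurePreserving_eval_seqLaw μ
  have hvi : Integrable (fun γ => max (w γ - M) 0) μ := (hwi.sub (integrable_const M)).pos_part
  have hvint : ∀ i, Integrable (fun h : ℕ → Γ => max (w (h i) - M) 0) (seqLaw μ) := fun i =>
    (hmp i).integrable_comp_of_integrable hvi
  have hE : ∀ i, ∫ h, max (w (h i) - M) 0 ∂(seqLaw μ) = δ := fun i => by
    have := integral_map (μ := seqLaw μ) (φ := fun g : ℕ → Γ => g i)
      (measurable_pi_apply i).aemeasurable (f := fun γ => max (w γ - M) 0)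
      (by rw [(hmp i).map_eq]; exact hvi.aestronglyMeasurable)
    rw [(hmp i).map_eq] at this
    exact this.symm
  -- On `A`, each `min w L` is at most `M + max (w - M) 0`. Keeping the indicator only on `M`
  -- requires no independence between `A` and the increments, and `L` enters only through `s * (n *
  -- L) ≤ 1`.
  set G : (ℕ → Γ) → ℝ := fun h => Real.exp (s * (n * l) / 8) *
    ((1 - s * (n * l) / 2) + s * (n * l) * I h
      + 2 * s * ∑ i ∈ Finset.range n, (M * I h + max (w (h i) - M) 0)) with hG
  have hterm0 : ∀ h : ℕ → Γ, 0 ≤ ∑ i ∈ Finset.range n, (M * I h + max (w (h i) - M) 0) :=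
    fun h => Finset.sum_nonneg fun i _ => add_nonneg (mul_nonneg hM (hI0 h)) (le_max_right _ _)
  have hsnl : 0 ≤ s * (n * l) := by positivity
  have hle : ∀ h : ℕ → Γ, Real.exp (s * (if h ∈ A then ∑ i ∈ Finset.range n, min (w (h i)) L
      + n * (l / 8) else n * (l / 8) - n * l)) ≤ G h := fun h => by
    have h1 : 0 ≤ 2 * s * ∑ i ∈ Finset.range n, (M * I h + max (w (h i) - M) 0) :=
      mul_nonneg (by linarith) (hterm0 h)
    split_ifs with hh
    · set ζ := ∑ i ∈ Finset.range n, min (w (h i)) L with hζ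
      have hζ0 : 0 ≤ ζ := Finset.sum_nonneg fun i _ => le_min (hw0 _) hL
      have hζL : ζ ≤ n * L := by
        simpa using Finset.sum_le_card_nsmul (Finset.range n) (fun i => min (w (h i)) L) L
          fun i _ => min_le_right _ _
      have hIh : I h = 1 := by simp [hI, hh]
      have hζM : ζ ≤ ∑ i ∈ Finset.range n, (M * I h + max (w (h i) - M) 0) :=
        Finset.sum_le_sum fun i _ => by
          rw [hIh]
          linarith [min_le_left (w (h i)) L, le_max_left (w (h i) - M) 0]
      have h2 := Real.exp_le_one_add_two_mul (t := s * ζ) (by positivity)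
        ((mul_le_mul_of_nonneg_left hζL hs).trans hsL)
      have h3 := mul_le_mul_of_nonneg_left hζM hs
      rw [show s * (ζ + n * (l / 8)) = s * (n * l) / 8 + s * ζ by ring, Real.exp_add]
      refine mul_le_mul_of_nonneg_left ?_ (Real.exp_pos _).le
      rw [hIh] at h3 ⊢
      linarith
    · rw [show s * (n * (l / 8) - n * l) = s * (n * l) / 8 + -(s * (n * l)) by ring, Real.exp_add]
      refine mul_le_mul_of_nonneg_left ?_ (Real.exp_pos _).le
      have h2 := Real.exp_neg_le_one_sub_half hsnl hsl
      have h3 := mul_nonneg hsnl (hI0 h)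
      linarith
  have hsumi : Integrable (fun h : ℕ → Γ => ∑ i ∈ Finset.range n,
      (M * I h + max (w (h i) - M) 0)) (seqLaw μ) :=
    integrable_finsetSum _ fun i _ => (hIi.const_mul M).add (hvint i)
  have hGi : Integrable G (seqLaw μ) :=
    (((integrable_const _).add (hIi.const_mul _)).add (hsumi.const_mul _)).const_mul _
  have hGint : ∫ h, G h ∂(seqLaw μ) = Real.exp (s * (n * l) / 8) *
      ((1 - s * (n * l) / 2) + s * (n * l) * p + 2 * s * (n * (M * p + δ))) := by
    have hIint : ∫ h, I h ∂(seqLaw μ) = p := integral_indicator_one hA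
    have hab : Integrable (fun h => 1 - s * (n * l) / 2 + s * (n * l) * I h) (seqLaw μ) :=
      (integrable_const _).add (hIi.const_mul _)
    have hti : ∀ i ∈ Finset.range n,
        Integrable (fun h : ℕ → Γ => M * I h + max (w (h i) - M) 0) (seqLaw μ) :=
      fun i _ => (hIi.const_mul M).add (hvint i)
    rw [hG, integral_const_mul, integral_add hab (hsumi.const_mul _), integral_add (integrable_const _) (hIi.const_mul _),
      integral_const_mul, integral_const_mul, hIint,
      integral_finsetSum _ hti]
    have : ∀ i ∈ Finset.range n, ∫ h, (M * I h + max (w (h i) - M) 0) ∂(seqLaw μ) = M * p + δ :=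
      fun i _ => by
        rw [integral_add (hIi.const_mul M) (hvint i), integral_const_mul, hIint, hE]
    rw [Finset.sum_congr rfl this, Finset.sum_const, Finset.card_range, nsmul_eq_mul,
      integral_const, probReal_univ, one_smul]
  calc _ ≤ ∫⁻ h, ENNReal.ofReal (G h) ∂(seqLaw μ) :=
        lintegral_mono fun h => ENNReal.ofReal_le_ofReal (hle h)
    _ = ENNReal.ofReal (∫ h, G h ∂(seqLaw μ)) :=
        (ofReal_integral_eq_lintegral_ofReal hGi (ae_of_all _ fun h =>
          (Real.exp_pos _).le.trans (hle h))).symm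
    _ ≤ _ := by
        refine ENNReal.ofReal_le_ofReal ?_
        rw [hGint]
        have h1 : p * l + 2 * (M * p + δ) ≤ l / 4 := by
          have := mul_le_mul_of_nonneg_right hAα hl
          have := mul_le_mul_of_nonneg_left hAα hM
          linarith
        have h2 : (1 - s * (n * l) / 2) + s * (n * l) * p + 2 * s * (n * (M * p + δ))
            ≤ 1 - s * (n * l) / 4 := by
          have h3 := mul_le_mul_of_nonneg_left h1 (show 0 ≤ s * n by positivity)
          linarith
        have h3 : 1 - s * (n * l) / 4 ≤ Real.exp (-(s * (n * l) / 4)) := by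
          linarith [Real.add_one_le_exp (-(s * (n * l) / 4))]
        calc _ ≤ Real.exp (s * (n * l) / 8) * Real.exp (-(s * (n * l) / 4)) := by
              gcongr
              exact h2.trans h3
          _ = _ := by rw [← Real.exp_add]; congr 1; ring

end Block

/-! ### The compensated height and its drift -/

section Height

variable {Γ Ω : Type*}

/-- The value of `f` along the trajectory, minus the waiting time of the queue fed by the
exceedances of `w` over the level `L`. -/
def compensatedHeight [SMul Γ Ω] (f : Ω → ℝ≥0∞) (w : Γ → ℝ) (L c : ℝ) (x : Ω) (g : ℕ → Γ)
    (k : ℕ) : ℝ :=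
  (f (trajectory g x k)).toReal - queue (fun γ => max (w γ - L) 0) c g k

section Path

variable [SMul Γ Ω] {f : Ω → ℝ≥0∞} {w : Γ → ℝ} {L c : ℝ} {x : Ω} {g : ℕ → Γ}

theorem lt_top_trajectory
    (hg : ∀ i, ∀ y, f y < ∞ → f (g i • y) ≤ f y + ENNReal.ofReal (w (g i))) (hx : f x < ∞) (k : ℕ) :
    f (trajectory g x k) < ∞ := by
  induction k with
  | zero => exact hx
  | succ k ih => exact (hg k _ ih).trans_lt (ENNReal.add_lt_top.2 ⟨ih, ENNReal.ofReal_lt_top⟩)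

/-- The queue absorbs the part of `w` above `L`; what remains is `min w L` plus the service `c`. -/
theorem compensatedHeight_add_le (hw0 : ∀ γ, 0 ≤ w γ)
    (hg : ∀ i, ∀ y, f y < ∞ → f (g i • y) ≤ f y + ENNReal.ofReal (w (g i))) (hx : f x < ∞)
    (m k : ℕ) : compensatedHeight f w L c x g (m + k) ≤ compensatedHeight f w L c x g m
      + ∑ i ∈ Finset.range k, min (w (g (m + i))) L + k * c := by
  induction k with
  | zero => simp
  | succ k ih =>
    refine le_trans ?_ ((add_le_add_left ih (min (w (g (m + k))) L + c)).trans_eq ?_)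
    · have hlt := lt_top_trajectory hg hx (m + k)
      have h1 : (f (trajectory g x (m + k + 1))).toReal
          ≤ (f (trajectory g x (m + k))).toReal + w (g (m + k)) := by
        have := ENNReal.toReal_mono (by finiteness) (hg (m + k) _ hlt)
        rwa [ENNReal.toReal_add hlt.ne ENNReal.ofReal_ne_top, ENNReal.toReal_ofReal (hw0 _)] at this
      have h2 := le_queue_succ (v := fun γ => max (w γ - L) 0) (c := c) g (m + k)
      simp only [compensatedHeight, ← add_assoc m k 1]
      rcases le_total (w (g (m + k))) L with h | h
      · rw [min_eq_left h]
        rw [max_eq_right (by linarith)] at h2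
        linarith
      · rw [min_eq_right h]
        rw [max_eq_left (by linarith)] at h2
        linarith
    · rw [Finset.sum_range_succ]
      push_cast
      ring

theorem compensatedHeight_add_le_const (hw0 : ∀ γ, 0 ≤ w γ)
    (hg : ∀ i, ∀ y, f y < ∞ → f (g i • y) ≤ f y + ENNReal.ofReal (w (g i))) (hx : f x < ∞)
    (m k : ℕ) : compensatedHeight f w L c x g (m + k)
      ≤ compensatedHeight f w L c x g m + k * (L + c) := by
  have h1 := compensatedHeight_add_le (L := L) (c := c) hw0 hg hx m k
  have h2 : ∑ i ∈ Finset.range k, min (w (g (m + i))) L ≤ k * L := by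
    simpa using Finset.sum_le_card_nsmul (Finset.range k) (fun i => min (w (g (m + i))) L) L
      fun i _ => min_le_right _ _
  linarith

theorem compensatedHeight_le_toReal (k : ℕ) :
    compensatedHeight f w L c x g k ≤ (f (trajectory g x k)).toReal :=
  sub_le_self _ (queue_nonneg g k)

theorem dependsOn_compensatedHeight (k : ℕ) :
    DependsOn (fun g : ℕ → Γ => compensatedHeight f w L c x g k) (Set.Iio k) := by
  intro g h H
  have h1 := dependsOn_trajectory x k H
  have h2 := dependsOn_queue (v := fun γ => max (w γ - L) 0) (c := c) k H
  simp only at h1 h2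
  simp only [compensatedHeight, h1, h2]

end Path

variable [Semigroup Γ] [MeasurableSpace Γ] [MeasurableMul₂ Γ]
  [TopologicalSpace Γ] [BorelSpace Γ] [TopologicalSpace Ω] [MeasurableSpace Ω]
  [BorelSpace Ω] [SemigroupAction Γ Ω] [ContinuousSMul Γ Ω]
  {μ : Measure Γ} [IsProbabilityMeasure μ] {f : Ω → ℝ≥0∞} {w : Γ → ℝ} {L c : ℝ}

theorem measurable_compensatedHeight (hf : Measurable f) (hw : Measurable w) (x : Ω) (k : ℕ) :
    Measurable (fun g : ℕ → Γ => compensatedHeight f w L c x g k) :=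
  (hf.comp (measurable_trajectory x k)).ennreal_toReal.sub
    (measurable_queue ((hw.sub_const L).max measurable_const) k)

/-- With the past frozen: if `f` is below `T` at the start of the block, bounded growth gives the
additive constant; otherwise `lintegral_exp_ite_le` gives the contraction. -/
theorem geometricDrift_compensatedHeight (hf : Measurable f) (hw : Measurable w)
    (hw0 : ∀ γ, 0 ≤ w γ) (hwi : Integrable w μ)
    (hctrl : ∀ᵐ γ ∂μ, ∀ y, f y < ∞ → f (γ • y) ≤ f y + ENNReal.ofReal (w γ))
    {n : ℕ} {l M α s : ℝ} (hl : 0 ≤ l) (hL : 0 ≤ L) (hM : 0 ≤ M)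
    (hs : 0 ≤ s) (hsL : s * (n * L) ≤ 1) (hsl : s * (n * l) ≤ 1)
    (hα : α * l + 2 * (M * α + ∫ γ, max (w γ - M) 0 ∂μ) ≤ l / 4) {T : ℝ≥0}
    (hdec : ∀ y, (T : ℝ≥0∞) ≤ f y → f y < ∞ → (seqLaw μ).real
      {h | ¬ f (trajectory h y n) + ENNReal.ofReal (n * l) ≤ f y} ≤ α) {x : Ω} (hx : f x < ∞) :
    GeometricDrift μ n (Real.exp (-(s * (n * l) / 8)))
      (Real.exp (s * (T + n * (L + l / 8))))
      (fun q g => Real.exp (s * compensatedHeight f w L (l / 8) x g (n * q))) where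
  measurable q := Real.measurable_exp.comp ((measurable_compensatedHeight hf hw x _).const_mul s)
  nonneg q g := (Real.exp_pos _).le
  dependsOn q := fun g h H => by
    have := dependsOn_compensatedHeight (f := f) (w := w) (L := L) (c := l / 8) (x := x) (n * q) H
    simp only at this
    simp only [this]
  drift q H hH hHd := by
    classical
    set U := compensatedHeight f w L (l / 8) x with hU
    have hUm : ∀ k, Measurable fun g => U g k := measurable_compensatedHeight hf hw x
    rw [lintegral_seqLaw_splice μ (n * q)
      (F := fun g => H g * ENNReal.ofReal (Real.exp (s * U g (n * (q + 1))))) (hH.mul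
      (Real.measurable_exp.comp ((hUm _).const_mul s)).ennreal_ofReal)]
    have hgood := ae_seqLaw_forall μ hctrl
    refine lintegral_mono_ae ?_
    filter_upwards [hgood] with g hg
    have hmeas : Measurable fun h => ENNReal.ofReal (Real.exp (s * U (splice (n * q) g h)
        (n * (q + 1)))) :=
      (Real.measurable_exp.comp (((hUm _).comp ((measurable_splice (n * q)).comp
        measurable_prodMk_left)).const_mul s)).ennreal_ofReal
    simp only [hHd.apply_splice]
    rw [lintegral_const_mul _ hmeas]
    refine mul_le_mul_right ?_ _
    set y := trajectory g x (n * q) with hy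
    have hfy : f y < ∞ := lt_top_trajectory hg hx _
    have hUsplice : ∀ h, U (splice (n * q) g h) (n * q) = U g (n * q) := fun h =>
      (dependsOn_compensatedHeight (n * q)).apply_splice g h
    have hsg : ∀ h : ℕ → Γ, (∀ i, ∀ y, f y < ∞ → f (h i • y) ≤ f y + ENNReal.ofReal (w (h i))) →
        ∀ i, ∀ y, f y < ∞ → f (splice (n * q) g h i • y)
          ≤ f y + ENNReal.ofReal (w (splice (n * q) g h i)) := fun h hh i => by
      by_cases hi : i < n * q
      · rw [splice_of_lt hi]; exact hg i
      · obtain ⟨j, rfl⟩ := Nat.exists_eq_add_of_le (not_lt.1 hi)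
        rw [splice_add]; exact hh j
    have hρY : 0 ≤ Real.exp (-(s * (n * l) / 8)) * Real.exp (s * U g (n * q)) := by positivity
    rcases lt_or_ge (f y) T with hT | hT
    · calc _ ≤ ∫⁻ _, ENNReal.ofReal (Real.exp (s * (T + n * (L + l / 8)))) ∂(seqLaw μ) := by
            refine lintegral_mono_ae ?_
            filter_upwards [hgood] with h hh
            refine ENNReal.ofReal_le_ofReal (Real.exp_le_exp.2 (mul_le_mul_of_nonneg_left ?_ hs))
            have h1 := compensatedHeight_add_le_const (L := L) (c := l / 8) hw0 (hsg h hh) hx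
              (n * q) n
            rw [← hU, hUsplice] at h1
            have h2 : U g (n * q) ≤ (f y).toReal := compensatedHeight_le_toReal _
            have h3 : (f y).toReal ≤ T := by
              simpa using ENNReal.toReal_mono ENNReal.coe_ne_top hT.le
            rw [mul_add_one]
            linarith
        _ = ENNReal.ofReal (Real.exp (s * (T + n * (L + l / 8)))) := by simp
        _ ≤ _ := ENNReal.ofReal_le_ofReal (by linarith)
    · set A : Set (ℕ → Γ) := {h | ¬ f (trajectory h y n) + ENNReal.ofReal (n * l) ≤ f y} with hA
      have hAm : MeasurableSet A := (measurableSet_le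
        ((hf.comp (measurable_trajectory y n)).add_const _) measurable_const).compl
      have hexp := lintegral_exp_ite_le hw0 hwi hl hL hM hs hsL hsl hα hAm (hdec y hT hfy)
      calc _ ≤ ∫⁻ h, ENNReal.ofReal (Real.exp (s * U g (n * q))) * ENNReal.ofReal (Real.exp (s *
            (if h ∈ A then ∑ i ∈ Finset.range n, min (w (h i)) L
              + n * (l / 8) else n * (l / 8) - n * l))) ∂(seqLaw μ) := by
            refine lintegral_mono_ae ?_
            filter_upwards [hgood] with h hh
            rw [← ENNReal.ofReal_mul (Real.exp_pos _).le, ← Real.exp_add, ← mul_add]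
            refine ENNReal.ofReal_le_ofReal (Real.exp_le_exp.2 (mul_le_mul_of_nonneg_left ?_ hs))
            rw [mul_add_one]
            split_ifs with hhA
            · have h1 := compensatedHeight_add_le (L := L) (c := l / 8) hw0 (hsg h hh) hx
                (n * q) n
              rw [← hU, hUsplice] at h1
              simp only [splice_add] at h1
              linarith
            · have hgd : f (trajectory h y n) + ENNReal.ofReal (n * l) ≤ f y := not_not.1 hhA
              have h1 : (f (trajectory h y n)).toReal + n * l ≤ (f y).toReal := by
                have hlt : f (trajectory h y n) < ∞ := (le_self_add.trans hgd).trans_lt hfy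
                have := ENNReal.toReal_mono hfy.ne hgd
                rwa [ENNReal.toReal_add hlt.ne ENNReal.ofReal_ne_top,
                  ENNReal.toReal_ofReal (by positivity)] at this
              -- Service during the block can cancel at most `n * (l / 8)` of the decrease of `f`.
              have h2 := sub_le_queue_add (v := fun γ => max (w γ - L) 0) (c := l / 8)
                (fun γ => le_max_right _ _) (splice (n * q) g h) (n * q) n
              have h3 : queue (fun γ => max (w γ - L) 0) (l / 8) (splice (n * q) g h) (n * q)
                  = queue (fun γ => max (w γ - L) 0) (l / 8) g (n * q) :=
                (dependsOn_queue (n * q)).apply_splice g h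
              rw [h3] at h2
              simp only [hU, compensatedHeight, trajectory_splice_add, ← hy]
              linarith
        _ = ENNReal.ofReal (Real.exp (s * U g (n * q))) * ∫⁻ h, ENNReal.ofReal (Real.exp (s *
            (if h ∈ A then ∑ i ∈ Finset.range n, min (w (h i)) L
              + n * (l / 8) else n * (l / 8) - n * l))) ∂(seqLaw μ) :=
            lintegral_const_mul' _ _ ENNReal.ofReal_ne_top
        _ ≤ ENNReal.ofReal (Real.exp (s * U g (n * q)))
            * ENNReal.ofReal (Real.exp (-(s * (n * l) / 8))) := by gcongr
        _ = ENNReal.ofReal (Real.exp (-(s * (n * l) / 8)) * Real.exp (s * U g (n * q))) := by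
            rw [mul_comm, ENNReal.ofReal_mul (Real.exp_pos _).le]
        _ ≤ _ := ENNReal.ofReal_le_ofReal (by linarith [Real.exp_pos (s * (T + n * (L + l / 8)))])

end Height

/-! ### Uniform tightness along trajectories -/

section Tightness

theorem exists_nat_integral_sub_pos_part_lt {Γ : Type*} [MeasurableSpace Γ] {μ : Measure Γ}
    [IsFiniteMeasure μ] {w : Γ → ℝ} (hw0 : ∀ γ, 0 ≤ w γ) (hwi : Integrable w μ) {δ : ℝ}
    (hδ : 0 < δ) : ∃ L : ℕ, ∫ γ, max (w γ - L) 0 ∂μ < δ := by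
  have hlim : Tendsto (fun L : ℕ => ∫ γ, max (w γ - L) 0 ∂μ) atTop (𝓝 (∫ _, (0 : ℝ) ∂μ)) := by
    refine tendsto_integral_of_dominated_convergence w
      (fun L => (hwi.sub (integrable_const (L : ℝ))).pos_part.aestronglyMeasurable) hwi
      (fun L => ae_of_all _ fun γ => ?_) (ae_of_all _ fun γ => ?_)
    · rw [Real.norm_of_nonneg (le_max_right _ _)]
      exact max_le (by linarith [(Nat.cast_nonneg L : (0 : ℝ) ≤ L)]) (hw0 γ)
    · refine tendsto_const_nhds.congr' ?_
      obtain ⟨N, hN⟩ := exists_nat_ge (w γ)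
      filter_upwards [eventually_ge_atTop N] with L hL
      have : (N : ℝ) ≤ L := by exact_mod_cast hL
      exact (max_eq_right (by linarith)).symm
  rw [integral_zero] at hlim
  exact (hlim.eventually_lt_const hδ).exists

theorem sum_range_mul_comp_div (F : ℕ → ℝ) {n : ℕ} (hn : 0 < n) (m : ℕ) :
    ∑ k ∈ Finset.range (n * m), F (k / n) = n * ∑ q ∈ Finset.range m, F q := by
  induction m with
  | zero => simp
  | succ m ih =>
    rw [mul_add_one, Finset.sum_range_add, ih, Finset.sum_range_succ, mul_add]
    congr 1
    rw [Finset.sum_congr rfl fun i hi => by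
      rw [Nat.mul_add_div hn, Nat.div_eq_of_lt (Finset.mem_range.1 hi), add_zero]]
    simp

/-- A counting function dominated by rare events at times and at blocks of times has small upper
density. -/
theorem limsup_ncard_div_lt {A : Set ℕ} {a d : ℕ → Prop} [DecidablePred a] [DecidablePred d]
    {n : ℕ} (hn : 0 < n) (hA : ∀ k ∈ A, a k ∨ d (k / n)) {ε : ℝ} (hε : 0 < ε)
    (ha : ∀ᶠ N : ℕ in atTop, ∑ k ∈ Finset.range N, (if a k then (1 : ℝ) else 0) ≤ ε / 4 * N)
    (hd : ∀ᶠ N : ℕ in atTop, ∑ k ∈ Finset.range N, (if d k then (1 : ℝ) else 0) ≤ ε / 4 * N) :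
    limsup (fun N : ℕ => ({k : ℕ | k ∈ Finset.Icc 1 N ∧ k ∈ A}.ncard : ℝ) / N) atTop < ε := by
  classical
  -- The two counts total at most `ε / 4 * (2 * N + n + 2)`, where `n + 2` comes from the extra time
  -- and the incomplete last block; `N ≥ n + 2` absorbs it.
  have hle : ∀ᶠ N : ℕ in atTop,
      ({k : ℕ | k ∈ Finset.Icc 1 N ∧ k ∈ A}.ncard : ℝ) / N ≤ 3 * ε / 4 := by
    have ht1 : Tendsto (fun N : ℕ => N + 1) atTop atTop := tendsto_add_atTop_nat 1
    have ht2 : Tendsto (fun N : ℕ => (N + 1) / n + 1) atTop atTop :=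
      (tendsto_add_atTop_nat 1).comp ((Nat.tendsto_div_const_atTop hn.ne').comp ht1)
    filter_upwards [ht1.eventually ha, ht2.eventually hd, eventually_gt_atTop 0,
      eventually_ge_atTop (n + 2)] with N h1 h2 hN hNn
    have hset : {k : ℕ | k ∈ Finset.Icc 1 N ∧ k ∈ A}
        = ((Finset.Icc 1 N).filter (· ∈ A) : Finset ℕ) := by ext k; simp
    have hblock : N + 1 ≤ n * ((N + 1) / n + 1) := (Nat.lt_mul_div_succ (N + 1) hn).le
    have hcard : ({k : ℕ | k ∈ Finset.Icc 1 N ∧ k ∈ A}.ncard : ℝ)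
        ≤ ∑ k ∈ Finset.range (N + 1), (if a k then (1 : ℝ) else 0)
          + n * ∑ q ∈ Finset.range ((N + 1) / n + 1), (if d q then (1 : ℝ) else 0) := by
      rw [hset, Set.ncard_coe_finset, Finset.card_filter, ← sum_range_mul_comp_div _ hn]
      push_cast
      calc ∑ k ∈ Finset.Icc 1 N, (if k ∈ A then (1 : ℝ) else 0)
          ≤ ∑ k ∈ Finset.range (N + 1), (if k ∈ A then (1 : ℝ) else 0) :=
            Finset.sum_le_sum_of_subset_of_nonneg
              (fun k hk => by simp at hk ⊢; omega) fun _ _ _ => by split_ifs <;> norm_num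
        _ ≤ ∑ k ∈ Finset.range (N + 1), ((if a k then (1 : ℝ) else 0)
            + (if d (k / n) then (1 : ℝ) else 0)) := by
            refine Finset.sum_le_sum fun k _ => ?_
            by_cases hk : k ∈ A
            · rcases hA k hk with h | h
              · rw [if_pos hk, if_pos h]; split_ifs <;> norm_num
              · rw [if_pos hk, if_pos h]; split_ifs <;> norm_num
            · rw [if_neg hk]; split_ifs <;> norm_num
        _ ≤ _ := by
            rw [Finset.sum_add_distrib]
            gcongr
    have hN' : (0 : ℝ) < N := by exact_mod_cast hN
    have hNn' : (n : ℝ) + 2 ≤ N := by exact_mod_cast hNn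
    have hfl : (n : ℝ) * (((N + 1) / n : ℕ) : ℝ) ≤ N + 1 := by
      exact_mod_cast Nat.mul_div_le (N + 1) n
    have h3 := mul_le_mul_of_nonneg_left h2 (Nat.cast_nonneg n : (0 : ℝ) ≤ n)
    rw [div_le_iff₀ hN']
    push_cast at h1 h3
    have h4 : (n : ℝ) * (ε / 4 * ((((N + 1) / n : ℕ) : ℝ) + 1)) ≤ ε / 4 * (N + 1 + n) := by
      have := mul_le_mul_of_nonneg_left hfl (by positivity : 0 ≤ ε / 4)
      linarith
    have h5 := mul_le_mul_of_nonneg_left hNn' (by positivity : 0 ≤ ε / 4)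
    linarith
  -- A real `limsup` is meaningful only with this bound.
  have hcob : IsCoboundedUnder (· ≤ ·) atTop
      (fun N : ℕ => ({k : ℕ | k ∈ Finset.Icc 1 N ∧ k ∈ A}.ncard : ℝ) / N) :=
    isCoboundedUnder_le_of_le atTop (x := 0) fun N => by positivity
  exact (limsup_le_of_le hcob hle).trans_lt (by linarith)

variable {Γ Ω : Type*} [Semigroup Γ] [MeasurableSpace Γ] [MeasurableMul₂ Γ]
  [TopologicalSpace Γ] [BorelSpace Γ] [TopologicalSpace Ω] [MeasurableSpace Ω]
  [BorelSpace Ω] [SemigroupAction Γ Ω] [ContinuousSMul Γ Ω]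
  {μ : Measure Γ} [IsProbabilityMeasure μ] {f : Ω → ℝ≥0∞} {w : Γ → ℝ}

/-- A function which probably decreases along the walk, and whose increments are dominated by an
integrable function of the instruction, is uniformly tight along trajectories. -/
theorem exists_level_of_drift (hf : Measurable f) (hw : Measurable w)
    (hw0 : ∀ γ, 0 ≤ w γ) (hwi : Integrable w μ)
    (hctrl : ∀ᵐ γ ∂μ, ∀ y, f y < ∞ → f (γ • y) ≤ f y + ENNReal.ofReal (w γ))
    {n : ℕ} (hn : 0 < n) {l M α : ℝ} (hl : 0 < l) (hM : 0 ≤ M)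
    (hα : α * l + 2 * (M * α + ∫ γ, max (w γ - M) 0 ∂μ) ≤ l / 4) {T : ℝ≥0}
    (hdec : ∀ y, (T : ℝ≥0∞) ≤ f y → f y < ∞ → (seqLaw μ).real
      {h | ¬ f (trajectory h y n) + ENNReal.ofReal (n * l) ≤ f y} ≤ α)
    (B : ℝ≥0) {ε : ℝ} (hε : 0 < ε) :
    ∃ R : ℝ≥0, ∀ x, f x ≤ B →
      (∀ k, seqLaw μ {g | (R : ℝ≥0∞) < f (trajectory g x k)} < ENNReal.ofReal ε) ∧
      ∀ᵐ g ∂(seqLaw μ), limsup (fun N : ℕ =>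
        ({k : ℕ | k ∈ Finset.Icc 1 N ∧ (R : ℝ≥0∞) < f (trajectory g x k)}.ncard : ℝ) / N) atTop
          < ε := by
  classical
  have hc : 0 < l / 8 := by positivity
  -- Makes the queue loaded with probability, and with frequency, at most `ε / 4`.
  obtain ⟨L, hLε⟩ := exists_nat_integral_sub_pos_part_lt hw0 hwi (δ := l / 8 * (ε / 4))
    (by positivity)
  set v : Γ → ℝ := fun γ => max (w γ - L) 0 with hv
  have hv0 : ∀ γ, 0 ≤ v γ := fun γ => le_max_right _ _
  have hvm : Measurable v := (hw.sub_const _).max measurable_const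
  have hvi : Integrable v μ := (hwi.sub (integrable_const (L : ℝ))).pos_part
  have hL0 : (0 : ℝ) ≤ L := Nat.cast_nonneg L
  have hn' : (0 : ℝ) < n := by exact_mod_cast hn
  set s : ℝ := 1 / (n * (L + l)) with hs
  have hs0 : 0 < s := by positivity
  have hsn : s * (n * (L + l)) = 1 := by rw [hs]; field_simp
  have hsL : s * (n * L) ≤ 1 := by
    have : 0 ≤ s * (n * l) := by positivity
    linarith
  have hsl : s * (n * l) ≤ 1 := by
    have : 0 ≤ s * (n * L) := by positivity
    linarith
  set ρ := Real.exp (-(s * (n * l) / 8)) with hρ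
  have hρ0 : 0 ≤ ρ := (Real.exp_pos _).le
  have hρ1 : ρ < 1 := Real.exp_lt_one_iff.2 (by
    have : 0 < s * (n * l) := by positivity
    linarith)
  set b := Real.exp (s * (T + n * (L + l / 8))) with hb
  have hb0 : 0 ≤ b := (Real.exp_pos _).le
  set U := fun x => compensatedHeight f w L (l / 8) x with hU
  have hdrift : ∀ x, f x < ∞ →
      GeometricDrift μ n ρ b (fun q g => Real.exp (s * U x g (n * q))) := fun x hx =>
    geometricDrift_compensatedHeight hf hw hw0 hwi hctrl hl.le hL0 hM hs0.le hsL hsl hα hdec hx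
  have hY0 : ∀ x, f x ≤ B → ∀ g, Real.exp (s * U x g (n * 0)) ≤ Real.exp (s * B) := fun x hx g => by
    refine Real.exp_le_exp.2 (mul_le_mul_of_nonneg_left ?_ hs0.le)
    refine (compensatedHeight_le_toReal _).trans ?_
    simpa [trajectory] using ENNReal.toReal_mono ENNReal.coe_ne_top hx
  set D := Real.exp (s * B) + b / (1 - ρ) with hD
  obtain ⟨y, hy⟩ := exists_ae_eventually_sum_exceedance_le (μ := μ) (n := n) hρ0 hρ1 hb0
    (show 0 < ε / 4 by positivity)
  -- `y` controls frequencies, `4 * D / ε` serves Markov's inequality at a fixed time, and `1`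
  -- ensures positivity.
  set z := max (max y (4 * D / ε)) 1 with hz
  have hz0 : 0 < z := lt_of_lt_of_le one_pos (le_max_right _ _)
  -- Bounds for the queue, for the growth of `U` within a block, and for `U` at the block's start.
  set r := l / 8 + n * (L + l / 8) + Real.log z / s with hr
  refine ⟨r.toNNReal, fun x hx => ?_⟩
  have hfx : f x < ∞ := hx.trans_lt ENNReal.coe_lt_top
  have hexceed : ∀ᵐ g ∂(seqLaw μ), ∀ k, ((r.toNNReal : ℝ≥0) : ℝ≥0∞) < f (trajectory g x k) →
      l / 8 ≤ queue v (l / 8) g k ∨ z < Real.exp (s * U x g (n * (k / n))) := by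
    filter_upwards [ae_seqLaw_forall μ hctrl] with g hg k hk
    by_contra! hcon
    have h1 := compensatedHeight_add_le_const (L := (L : ℝ)) (c := l / 8) hw0 hg hfx
      (n * (k / n)) (k % n)
    rw [Nat.div_add_mod] at h1
    have h2 : ((k % n : ℕ) : ℝ) * (L + l / 8) ≤ n * (L + l / 8) := by
      gcongr
      exact (Nat.mod_lt k hn).le
    have h3 : s * U x g (n * (k / n)) ≤ Real.log z := by
      rw [Real.le_log_iff_exp_le hz0]; exact hcon.2
    have h4 : U x g (n * (k / n)) ≤ Real.log z / s := by
      rw [le_div_iff₀ hs0]; linarith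
    have h5 : r < (f (trajectory g x k)).toReal := by
      have := (ENNReal.toReal_lt_toReal ENNReal.coe_ne_top
        (lt_top_trajectory hg hfx k).ne).2 hk
      rw [ENNReal.coe_toReal, Real.coe_toNNReal'] at this
      exact (le_max_left _ _).trans_lt this
    have h6 : compensatedHeight f w L (l / 8) x g k
      = (f (trajectory g x k)).toReal - queue v (l / 8) g k := rfl
    have h7 := hcon.1
    simp only [hU] at h4
    linarith
  refine ⟨fun k => ?_, ?_⟩
  · have hP1 : seqLaw μ {g | l / 8 ≤ queue v (l / 8) g k} ≤ ENNReal.ofReal (ε / 4) := by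
      rw [← ofReal_measureReal]
      refine ENNReal.ofReal_le_ofReal (le_of_mul_le_mul_left ?_ hc)
      exact (mul_measureReal_le_queue_le hv0 hvm hvi hc.le k).trans hLε.le
    have hP2 : seqLaw μ {g | z < Real.exp (s * U x g (n * (k / n)))} ≤ ENNReal.ofReal (ε / 4) := by
      have hE := (hdrift x hfx).lintegral_le hρ0 hρ1 hb0 (Real.exp_pos _).le (hY0 x hx) (k / n)
      have hm := mul_meas_ge_le_lintegral (μ := seqLaw μ)
        ((hdrift x hfx).measurable (k / n)).ennreal_ofReal (ENNReal.ofReal z)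
      have hDz : D ≤ ε / 4 * z := by
        have : 4 * D / ε ≤ z := (le_max_right _ _).trans (le_max_left _ _)
        rw [div_le_iff₀ hε] at this
        linarith
      have hsub : {g | z < Real.exp (s * U x g (n * (k / n)))} ⊆
          {g | ENNReal.ofReal z ≤ ENNReal.ofReal (Real.exp (s * U x g (n * (k / n))))} :=
        fun g hg => ENNReal.ofReal_le_ofReal (le_of_lt hg)
      have hfin : ENNReal.ofReal z * seqLaw μ {g | z < Real.exp (s * U x g (n * (k / n)))}
          ≤ ENNReal.ofReal z * ENNReal.ofReal (ε / 4) := by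
        rw [← ENNReal.ofReal_mul hz0.le]
        refine ((mul_le_mul_right (measure_mono hsub) _).trans (hm.trans hE)).trans ?_
        exact ENNReal.ofReal_le_ofReal (by linarith)
      exact (ENNReal.mul_le_mul_iff_right (by simpa using hz0) ENNReal.ofReal_ne_top).1 hfin
    calc seqLaw μ {g | ((r.toNNReal : ℝ≥0) : ℝ≥0∞) < f (trajectory g x k)}
        ≤ seqLaw μ ({g | l / 8 ≤ queue v (l / 8) g k}
            ∪ {g | z < Real.exp (s * U x g (n * (k / n)))}) := by
          refine measure_mono_ae ?_
          filter_upwards [hexceed] with g hg hgr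
          exact hg k hgr
      _ ≤ ENNReal.ofReal (ε / 4) + ENNReal.ofReal (ε / 4) :=
          (measure_union_le _ _).trans (add_le_add hP1 hP2)
      _ < ENNReal.ofReal ε := by
          rw [← ENNReal.ofReal_add (by positivity) (by positivity)]
          exact (ENNReal.ofReal_lt_ofReal_iff hε).2 (by linarith)
  · filter_upwards [hexceed, ae_eventually_sum_queue_le hv0 hvm hvi hc hLε,
      hy _ (hdrift x hfx) _ (hY0 x hx)] with g hg hg1 hg2
    refine limsup_ncard_div_lt (A := {k | ((r.toNNReal : ℝ≥0) : ℝ≥0∞) < f (trajectory g x k)})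
      (a := fun k => l / 8 ≤ queue v (l / 8) g k)
      (d := fun q => z < Real.exp (s * U x g (n * q))) hn (fun k hk => hg k hk) hε hg1 ?_
    filter_upwards [hg2] with N hN
    refine le_trans (Finset.sum_le_sum fun q _ => ?_) hN
    have hyz : y ≤ z := (le_max_left _ _).trans (le_max_left _ _)
    split_ifs with h1 h2 h2
    · exact le_rfl
    · exact absurd (hyz.trans_lt h1) h2
    · exact zero_le_one
    · exact le_rfl

end Tightness

end

/-! ### The theorem -/

theorem mainTheorem6 {Γ Ω : Type*}
    [Semigroup Γ] [TopologicalSpace Γ] [ContinuousMul Γ]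
    [MeasurableSpace Γ] [BorelSpace Γ] [MeasurableMul₂ Γ]
    [TopologicalSpace Ω] [LocallyCompactSpace Ω] [MeasurableSpace Ω] [BorelSpace Ω]
    [SemigroupAction Γ Ω] [ContinuousSMul Γ Ω]
    (μ : Measure Γ) [IsProbabilityMeasure μ]
    (S : Set (Set (OnePoint Ω) × Set (OnePoint Ω)))
    (hS : ControlledDrift μ S {(Set.univ : Set Ω)})
    (Y : Set (OnePoint Ω)) (hY : Y ∈ Prod.fst '' S)
    (K : Set Ω) (hK : IsCompact K) (hKY : Disjoint ((↑) '' K) Y) :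
    ∃ Y', (Y, Y') ∈ S ∧ ∀ ε > (0 : ℝ), ∃ O' : Set Ω, IsNbhdOf O' Y' ∧ ∀ x ∈ K,
      (∀ n : ℕ, stepLaw μ n x O' < ENNReal.ofReal ε) ∧
      ∀ᵐ g : ℕ → Γ ∂(Measure.infinitePi (fun _ : ℕ => μ)),
        limsup (fun n : ℕ =>
          ({k : ℕ | k ∈ Finset.Icc 1 n ∧ trajectory g x k ∈ O'}.ncard : ℝ) / n) atTop < ε := by
  obtain ⟨V, _, _, _, _, Φ, -, hint, l, hl, C, -, hdrift⟩ := hS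
  -- `Φ` is not assumed measurable; a measurable version of `log ‖Φ‖` is used, so the control holds
  -- for almost every instruction.
  set φ := hint.aestronglyMeasurable.mk (fun g => Real.log ‖Φ g‖) with hφ
  have hφm : Measurable φ := hint.aestronglyMeasurable.stronglyMeasurable_mk.measurable
  have hφe : (fun g => Real.log ‖Φ g‖) =ᵐ[μ] φ := hint.aestronglyMeasurable.ae_eq_mk
  set w : Γ → ℝ := fun γ => max (C * φ γ) 0 with hw
  have hwm : Measurable w := (hφm.const_mul C).max measurable_const
  have hw0 : ∀ γ, 0 ≤ w γ := fun γ => le_max_right _ _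
  have hwi : Integrable w μ := ((hint.congr hφe).const_mul C).pos_part
  obtain ⟨M, hMδ⟩ := exists_nat_integral_sub_pos_part_lt hw0 hwi (δ := l / 32) (by positivity)
  have hM0 : (0 : ℝ) ≤ M := Nat.cast_nonneg M
  -- The block condition costs `α * (l + 2 * M) = l / 8` plus less than `2 * (l / 32)`, within the
  -- allowed `l / 4`.
  set α : ℝ := l / (8 * (l + 2 * M)) with hα
  have hα0 : 0 < α := by positivity
  have hαl : α * (l + 2 * M) = l / 8 := by rw [hα]; field_simp
  obtain ⟨N, hN1, hN⟩ := hdrift α hα0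
  obtain ⟨Y', hY', f, hfd⟩ := hN N le_rfl Y hY K hK hKY Set.univ rfl
  obtain ⟨B, hB⟩ := hfd.bounded_on
  obtain ⟨T, hT⟩ := hfd.probable_decrease
  have hctrl : ∀ᵐ γ ∂μ, ∀ y, f y < ∞ → f (γ • y) ≤ f y + ENNReal.ofReal (w γ) := by
    filter_upwards [hφe] with γ hγ y hy
    refine (hfd.control_of_variations y hy γ).trans ?_
    gcongr
    rw [hγ]
    exact le_max_left _ _
  have hdec : ∀ y, (T : ℝ≥0∞) ≤ f y → f y < ∞ → (seqLaw μ).real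
      {h | ¬ f (trajectory h y N) + ENNReal.ofReal (N * l) ≤ f y} ≤ α := fun y hTy hy => by
    obtain ⟨m, rfl⟩ := Nat.exists_eq_add_of_le' hN1
    have hgm : MeasurableSet {h : ℕ → Γ | f (trajectory h y (m + 1))
        + ENNReal.ofReal ((m + 1 : ℕ) * l) ≤ f y} :=
      measurableSet_le ((hfd.measurable.comp (measurable_trajectory y (m + 1))).add_const _)
        measurable_const
    have hsm : MeasurableSet {γ : Γ | f (γ • y) + ENNReal.ofReal ((m + 1 : ℕ) * l) ≤ f y} :=
      measurableSet_le ((hfd.measurable.comp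
        (show Continuous fun γ : Γ => γ • y by fun_prop).measurable).add_const _) measurable_const
    have h1 := hT y (Set.mem_univ y) hTy hy
    rw [← map_leftProd_seqLaw, Measure.map_apply (measurable_leftProd m) hsm] at h1
    have h2 : 1 - α ≤ (seqLaw μ).real {h : ℕ → Γ | f (trajectory h y (m + 1))
        + ENNReal.ofReal ((m + 1 : ℕ) * l) ≤ f y} := by
      simp only [trajectory_succ_eq_leftProd_smul]
      exact (ENNReal.ofReal_le_iff_le_toReal (measure_ne_top _ _)).1 h1
    have h3 := probReal_compl_eq_one_sub (μ := seqLaw μ) hgm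
    rw [Set.compl_ofPred] at h3
    linarith
  refine ⟨Y', hY', fun ε hε => ?_⟩
  obtain ⟨R, hR⟩ := exists_level_of_drift hfd.measurable hwm hw0 hwi hctrl hN1 hl hM0
    (by linarith) hdec B hε
  refine ⟨{x | (R : ℝ≥0∞) < f x}, hfd.upper_level R, fun x hx => ⟨fun n => ?_, ?_⟩⟩
  · rw [stepLaw_apply μ n x (measurableSet_lt measurable_const hfd.measurable)]
    exact (hR x (hB x hx)).1 n
  · exact (hR x (hB x hx)).2
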